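/- Let $\beta_1,\beta_2$ be non-constant rational functions with complex coefficients, regarded as maps of the Riemann sphere $\mathbb{C}\cup\{\infty\}$ to itself, and let $K_1,K_2$ be subsets of $\mathbb{R}$ such that the intersection $\beta_1^{-1}(K_1)\cap\beta_2^{-1}(K_2)$ is infinite. Then there exist a complex rational function $W$ and rational functions $P_1,P_2$ with real coefficients such that $\beta_1=P_1\circ W$ and $\beta_2=P_2\circ W$. -/

import Mathlib

/-- The self-map of the Riemann sphere `ℂ ∪ {∞}` defined by a complex rational function.
The fraction `f.num / f.denom` is in lowest terms, so a zero of `f.denom` is a pole, and the value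
at `∞` is the limit of `f z` as `z → ∞`. -/
noncomputable def RatFunc.sphereMap (f : RatFunc ℂ) : OnePoint ℂ → OnePoint ℂ
  | OnePoint.some z =>
      open Classical in
      if f.denom.eval z = 0 then OnePoint.infty
      else OnePoint.some (f.num.eval z / f.denom.eval z)
  | OnePoint.infty =>
      open Classical in
      if f.denom.natDegree < f.num.natDegree then OnePoint.infty
      else OnePoint.some (f.num.coeff f.denom.natDegree / f.denom.leadingCoeff)

/-- A set of real numbers viewed as a subset of the Riemann sphere, via `ℝ ⊆ ℂ ⊆ ℂ ∪ {∞}`. -/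
def realSetInSphere (K : Set ℝ) : Set (OnePoint ℂ) :=
  (fun x : ℝ => OnePoint.some (x : ℂ)) '' K

/-- The composition `P ∘ W` of a rational function `P` with real coefficients and a complex
rational function `W`: the element `P(W) = P.num(W) / P.denom(W)` of `ℂ(z)`. The denominator
`P.denom(W)` can vanish only if `W` is constant, and then `compReal P W` is constant. -/
noncomputable def RatFunc.compReal (P : RatFunc ℝ) (W : RatFunc ℂ) : RatFunc ℂ :=
  P.eval (RatFunc.C.comp (algebraMap ℝ ℂ)) W

/-! Both functions are real on the infinite set S of finite common preimages. Along l = cofinite ⊓ 𝓟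
S a rational function is determined by its values, so conjugation of values is a partial field
involution on ℂ(z), with domain the field L of `conjugableField`. By Lüroth, L = ℂ(w). The conjugate
w' of w also generates L, hence is a Möbius function of w (`exists_bilinear_relation`). With w = a +
ib, where a and b are real along l, this relation puts (a, b) on a real line or circle
(`exists_circle_relation`). A rational parametrization gives W, real along l, with L ⊆ ℂ(W)
(`exists_real_parameter`). Elements of L that are real along l are then real functions of W
(`exists_eq_compReal`). -/

open Filter ComplexConjugate IntermediateField

namespace RatFunc

/-! ### Evaluation outside finite sets -/

section EventualEvaluation

variable {k : Type*} [Field k] {l : Filter k}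

theorem eventually_polynomial_eval_ne_zero (hl : l ≤ cofinite) {p : Polynomial k} (hp : p ≠ 0) :
    ∀ᶠ t in l, p.eval t ≠ 0 := by
  refine hl ?_
  change {t | p.eval t ≠ 0} ∈ cofinite
  rw [mem_cofinite]
  refine (Polynomial.finite_setOfPred_isRoot hp).subset fun t ht => ?_
  simpa using ht

theorem eventually_eval_add (hl : l ≤ cofinite) (x y : RatFunc k) :
    ∀ᶠ t in l, (x + y).eval (RingHom.id k) t
      = x.eval (RingHom.id k) t + y.eval (RingHom.id k) t := by
  filter_upwards [eventually_polynomial_eval_ne_zero hl x.denom_ne_zero,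
    eventually_polynomial_eval_ne_zero hl y.denom_ne_zero] with t hx hy
  exact eval_add _ _ (by simpa using hx) (by simpa using hy)

theorem eventually_eval_mul (hl : l ≤ cofinite) (x y : RatFunc k) :
    ∀ᶠ t in l, (x * y).eval (RingHom.id k) t
      = x.eval (RingHom.id k) t * y.eval (RingHom.id k) t := by
  filter_upwards [eventually_polynomial_eval_ne_zero hl x.denom_ne_zero,
    eventually_polynomial_eval_ne_zero hl y.denom_ne_zero] with t hx hy
  exact eval_mul _ _ (by simpa using hx) (by simpa using hy)

theorem eventually_eval_inv (hl : l ≤ cofinite) (x : RatFunc k) :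
    ∀ᶠ t in l, (x⁻¹).eval (RingHom.id k) t = (x.eval (RingHom.id k) t)⁻¹ := by
  rcases eq_or_ne x 0 with rfl | hx
  · simp
  · filter_upwards [eventually_eval_mul hl x x⁻¹] with t ht
    rw [mul_inv_cancel₀ hx, eval_one] at ht
    exact eq_inv_of_mul_eq_one_right ht.symm

/-- The numerator of a nonzero difference has only finitely many roots. -/
theorem eq_of_eventually_eval_eq [l.NeBot] (hl : l ≤ cofinite) {x y : RatFunc k}
    (h : ∀ᶠ t in l, x.eval (RingHom.id k) t = y.eval (RingHom.id k) t) : x = y := by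
  by_contra hxy
  have hne : x - y ≠ 0 := sub_ne_zero.mpr hxy
  obtain ⟨t, h₁, h₂, h₃, h₄⟩ := (h.and <| (eventually_eval_add hl (x - y) y).and <|
    (eventually_polynomial_eval_ne_zero hl (num_ne_zero hne)).and
      (eventually_polynomial_eval_ne_zero hl (x - y).denom_ne_zero)).exists
  rw [sub_add_cancel, h₁] at h₂
  exact div_ne_zero h₃ h₄ (by simpa [eval, Polynomial.eval₂_id] using h₂)

end EventualEvaluation

/-! ### Conjugation along a filter -/

/-- The values of `y` are eventually the complex conjugates of those of `x` along `l`. -/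
def ConjAlong (l : Filter ℂ) (x y : RatFunc ℂ) : Prop :=
  ∀ᶠ t in l, y.eval (RingHom.id ℂ) t = conj (x.eval (RingHom.id ℂ) t)

namespace ConjAlong

variable {l : Filter ℂ} {x y z u v : RatFunc ℂ}

theorem C (c : ℂ) : ConjAlong l (RatFunc.C c) (RatFunc.C (conj c)) := by
  simp [ConjAlong]

theorem symm (h : ConjAlong l x y) : ConjAlong l y x := by
  filter_upwards [h] with t ht
  simp [ht]

theorem add (hl : l ≤ cofinite) (h : ConjAlong l x y) (h' : ConjAlong l u v) :
    ConjAlong l (x + u) (y + v) := by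
  filter_upwards [h, h', eventually_eval_add hl x u, eventually_eval_add hl y v]
    with t h₁ h₂ h₃ h₄
  rw [h₃, h₄, h₁, h₂, map_add]

theorem mul (hl : l ≤ cofinite) (h : ConjAlong l x y) (h' : ConjAlong l u v) :
    ConjAlong l (x * u) (y * v) := by
  filter_upwards [h, h', eventually_eval_mul hl x u, eventually_eval_mul hl y v]
    with t h₁ h₂ h₃ h₄
  rw [h₃, h₄, h₁, h₂, map_mul]

theorem inv (hl : l ≤ cofinite) (h : ConjAlong l x y) : ConjAlong l x⁻¹ y⁻¹ := by
  filter_upwards [h, eventually_eval_inv hl x, eventually_eval_inv hl y] with t h₁ h₂ h₃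
  rw [h₂, h₃, h₁, map_inv₀]

theorem neg (hl : l ≤ cofinite) (h : ConjAlong l x y) : ConjAlong l (-x) (-y) := by
  simpa using (C (-1)).mul hl h

theorem sub (hl : l ≤ cofinite) (h : ConjAlong l x y) (h' : ConjAlong l u v) :
    ConjAlong l (x - u) (y - v) := by
  simpa only [sub_eq_add_neg] using h.add hl (h'.neg hl)

theorem div (hl : l ≤ cofinite) (h : ConjAlong l x y) (h' : ConjAlong l u v) :
    ConjAlong l (x / u) (y / v) := by
  simpa only [div_eq_mul_inv] using h.mul hl (h'.inv hl)

theorem C_ofReal (c : ℝ) : ConjAlong l (RatFunc.C (c : ℂ)) (RatFunc.C (c : ℂ)) := by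
  simpa using C (l := l) c

theorem unique [l.NeBot] (hl : l ≤ cofinite) (h : ConjAlong l x y) (h' : ConjAlong l x z) :
    y = z := by
  refine eq_of_eventually_eval_eq hl ?_
  filter_upwards [h, h'] with t h₁ h₂
  rw [h₁, h₂]

theorem eval₂ (hl : l ≤ cofinite) (h : ConjAlong l x y) (p : Polynomial ℂ) :
    ConjAlong l (p.eval₂ RatFunc.C x) ((p.map (starRingEnd ℂ)).eval₂ RatFunc.C y) := by
  induction p using Polynomial.induction_on with
  | C c => simpa using C c
  | add p q hp hq => simpa [Polynomial.eval₂_add] using hp.add hl hq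
  | monomial n c hn =>
    simpa [Polynomial.eval₂_mul, Polynomial.eval₂_pow, pow_succ, mul_assoc] using hn.mul hl h

theorem eval₂_ofReal (hl : l ≤ cofinite) (h : ConjAlong l x x) (p : Polynomial ℝ) :
    ConjAlong l (p.eval₂ (RatFunc.C.comp (algebraMap ℝ ℂ)) x)
      (p.eval₂ (RatFunc.C.comp (algebraMap ℝ ℂ)) x) := by
  have := h.eval₂ hl (p.map (algebraMap ℝ ℂ))
  rw [Polynomial.map_map] at this
  have e : (starRingEnd ℂ).comp (algebraMap ℝ ℂ) = algebraMap ℝ ℂ := by ext; simp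
  rwa [e, Polynomial.eval₂_map] at this

/-- Real and imaginary parts of functions with real values along `l` are well defined. -/
theorem eq_zero_of_add_I_mul [l.NeBot] (hl : l ≤ cofinite) (hx : ConjAlong l x x)
    (hy : ConjAlong l y y) (h : x + RatFunc.C Complex.I * y = 0) : x = 0 ∧ y = 0 := by
  have h₁ : ConjAlong l 0 (x - RatFunc.C Complex.I * y) := by
    have := hx.add hl ((C Complex.I).mul hl hy)
    rw [h] at this
    simpa [sub_eq_add_neg] using this
  have h₂ := h₁.unique hl (by simpa using C (l := l) 0)
  have hx0 : x = 0 := by linear_combination (h + h₂) / 2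
  subst hx0
  refine ⟨rfl, ?_⟩
  have hI : RatFunc.C Complex.I ≠ 0 := (_root_.map_ne_zero _).mpr Complex.I_ne_zero
  simpa [hI] using h

/-- A sum of two squares of functions with real values along `l` is not a negative constant. -/
theorem nonneg_of_sq_add_sq [l.NeBot] (hl : l ≤ cofinite) (hx : ConjAlong l x x)
    (hy : ConjAlong l y y) {r : ℝ} (h : x * x + y * y = RatFunc.C (r : ℂ)) : 0 ≤ r := by
  obtain ⟨t, h₁, h₂, h₃, h₄, h₅⟩ := (hx.and <| hy.and <| (eventually_eval_mul hl x x).and <|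
    (eventually_eval_mul hl y y).and <| eventually_eval_add hl (x * x) (y * y)).exists
  rw [h, h₃, h₄, eval_C] at h₅
  obtain ⟨a, ha⟩ := Complex.conj_eq_iff_real.mp h₁.symm
  obtain ⟨b, hb⟩ := Complex.conj_eq_iff_real.mp h₂.symm
  rw [ha, hb] at h₅
  have : r = a * a + b * b := by
    apply Complex.ofReal_injective
    simpa using h₅
  rw [this]
  exact add_nonneg (mul_self_nonneg a) (mul_self_nonneg b)

end ConjAlong

/-- The field of rational functions that have a conjugate along `l`. -/
def conjugableField (l : Filter ℂ) (hl : l ≤ cofinite) : IntermediateField ℂ (RatFunc ℂ) where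
  carrier := {x | ∃ y, ConjAlong l x y}
  mul_mem' := fun ⟨_, h⟩ ⟨_, h'⟩ => ⟨_, h.mul hl h'⟩
  add_mem' := fun ⟨_, h⟩ ⟨_, h'⟩ => ⟨_, h.add hl h'⟩
  algebraMap_mem' c := ⟨_, ConjAlong.C c⟩
  inv_mem' := fun _ ⟨_, h⟩ => ⟨_, h.inv hl⟩

/-! ### Generators of simple extensions -/

theorem mem_adjoin_simple_iff_eval₂ {k : Type*} [Field k] {w x : RatFunc k} :
    x ∈ k⟮w⟯ ↔ ∃ p q : Polynomial k, x = p.eval₂ C w / q.eval₂ C w := by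
  rw [mem_adjoin_simple_iff]
  rfl

/-- If a conjugable field is generated by `w`, it is generated by the conjugate of `w`. -/
theorem ConjAlong.conjugableField_le_adjoin {l : Filter ℂ} [l.NeBot] (hl : l ≤ cofinite)
    {w w' : RatFunc ℂ} (h : ConjAlong l w w') (hw : conjugableField l hl ≤ ℂ⟮w⟯) :
    conjugableField l hl ≤ ℂ⟮w'⟯ := by
  rintro x ⟨y, hxy⟩
  -- The conjugate y of x is p(w)/q(w); conjugating back expresses x through w'.
  obtain ⟨p, q, rfl⟩ := mem_adjoin_simple_iff_eval₂.mp (hw ⟨x, hxy.symm⟩)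
  rw [mem_adjoin_simple_iff_eval₂]
  exact ⟨_, _, hxy.symm.unique hl ((h.eval₂ hl p).div hl (h.eval₂ hl q))⟩

/-- Two generators of the same simple transcendental extension satisfy a bilinear relation. -/
theorem exists_bilinear_relation {k : Type*} [Field k] {w w' : RatFunc k}
    (hw : Transcendental k w) (h : k⟮w⟯ = k⟮w'⟯) :
    ∃ p q r s : k, ¬(p = 0 ∧ q = 0 ∧ r = 0 ∧ s = 0) ∧
      w' * (C r * w + C s) = C p * w + C q := by
  have hmem : w' ∈ k⟮w⟯ := h ▸ mem_adjoin_simple_self k w'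
  set e := algEquivOfTranscendental w hw
  set g : RatFunc k := e.symm ⟨w', hmem⟩ with hg
  have hge : ((e g : k⟮w⟯) : RatFunc k) = w' := by simp [hg]
  have htop : k⟮g⟯ = ⊤ := by
    have : (k⟮g⟯).map ((val k⟮w⟯).comp e.toAlgHom)
        = (⊤ : IntermediateField k (RatFunc k)).map ((val k⟮w⟯).comp e.toAlgHom) := by
      rw [← adjoin_X, adjoin_map, adjoin_map]
      simp only [Set.image_singleton]
      change k⟮((e g : k⟮w⟯) : RatFunc k)⟯ = k⟮((e X : k⟮w⟯) : RatFunc k)⟯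
      rw [hge, algEquivOfTranscendental_X, h]
    exact IntermediateField.map_injective _ this
  -- Here g is w' written in the variable w. It generates k(X), so its degree is 1.
  have hdeg := g.finrank_eq_max_natDegree
  rw [htop, IntermediateField.finrank_top] at hdeg
  have hn : g.num.natDegree ≤ 1 := hdeg ▸ le_max_left _ _
  have hd : g.denom.natDegree ≤ 1 := hdeg ▸ le_max_right _ _
  obtain ⟨p, q, hpq⟩ := Polynomial.exists_eq_X_add_C_of_natDegree_le_one hn
  obtain ⟨r, s, hrs⟩ := Polynomial.exists_eq_X_add_C_of_natDegree_le_one hd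
  have hval := algEquivOfTranscendental_apply w hw g
  rw [hge] at hval
  refine ⟨p, q, r, s, fun ⟨_, _, hr, hs⟩ => g.denom_ne_zero (by simp [hrs, hr, hs]), ?_⟩
  have hden : Polynomial.aeval w g.denom ≠ 0 := fun h0 =>
    g.denom_ne_zero ((transcendental_iff.mp hw) _ h0)
  rw [eq_div_iff hden] at hval
  simpa [hpq, hrs, algebraMap_eq_C] using hval

/-! ### Real functions of a real parameter -/

theorem exists_real_imaginary_parts (p : Polynomial ℂ) : ∃ p₁ p₂ : Polynomial ℝ,
    p = p₁.map (algebraMap ℝ ℂ) + Polynomial.C Complex.I * p₂.map (algebraMap ℝ ℂ) := by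
  induction p using Polynomial.induction_on' with
  | add p q hp hq =>
    obtain ⟨p₁, p₂, hp⟩ := hp
    obtain ⟨q₁, q₂, hq⟩ := hq
    refine ⟨p₁ + q₁, p₂ + q₂, ?_⟩
    rw [hp, hq, Polynomial.map_add, Polynomial.map_add]
    ring
  | monomial n c =>
    refine ⟨Polynomial.monomial n c.re, Polynomial.monomial n c.im, ?_⟩
    rw [Polynomial.map_monomial, Polynomial.map_monomial, Polynomial.C_mul_monomial, ← map_add]
    congr 1
    simp [mul_comm Complex.I, Complex.re_add_im]

theorem eval₂_real_ne_zero {W : RatFunc ℂ} (hW : Transcendental ℂ W) {p : Polynomial ℝ}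
    (hp : p ≠ 0) : p.eval₂ (C.comp (algebraMap ℝ ℂ)) W ≠ 0 := by
  intro h
  rw [← Polynomial.eval₂_map] at h
  have := (transcendental_iff.mp hW) _ h
  exact hp ((Polynomial.map_eq_zero _).mp this)

/-- `eval` uses the reduced fraction, and p / q need not be reduced. Transcendence of W keeps all
denominators nonzero, so multiplicativity of `eval` applies. -/
theorem compReal_div {W : RatFunc ℂ} (hW : Transcendental ℂ W) (p : Polynomial ℝ)
    {q : Polynomial ℝ} (hq : q ≠ 0) :
    (algebraMap _ (RatFunc ℝ) p / algebraMap _ (RatFunc ℝ) q).compReal W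
      = p.eval₂ (C.comp (algebraMap ℝ ℂ)) W / q.eval₂ (C.comp (algebraMap ℝ ℂ)) W := by
  set P := algebraMap _ (RatFunc ℝ) p / algebraMap _ (RatFunc ℝ) q
  have hP : P * algebraMap _ (RatFunc ℝ) q = algebraMap _ (RatFunc ℝ) p :=
    div_mul_cancel₀ _ (algebraMap_ne_zero hq)
  rw [eq_div_iff (eval₂_real_ne_zero hW hq)]
  have := eval_mul (f := C.comp (algebraMap ℝ ℂ)) (a := W) (x := P)
    (y := algebraMap _ (RatFunc ℝ) q) (eval₂_real_ne_zero hW P.denom_ne_zero)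
    (eval₂_real_ne_zero hW (denom_ne_zero _))
  rw [hP, eval_algebraMap, eval_algebraMap] at this
  exact this.symm

/-- If `W` and `β` have real values along `l`, and `β` is a function of `W`, then it is a real
function of `W`. -/
theorem exists_eq_compReal {l : Filter ℂ} [l.NeBot] (hl : l ≤ cofinite) {W β : RatFunc ℂ}
    (hW : Transcendental ℂ W) (hWl : ConjAlong l W W) (hβ : ConjAlong l β β)
    (hmem : β ∈ ℂ⟮W⟯) : ∃ P : RatFunc ℝ, β = P.compReal W := by
  obtain ⟨p, q, hpq⟩ := mem_adjoin_simple_iff_eval₂.mp hmem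
  by_cases hq0 : q = 0
  · subst hq0
    exact ⟨0, by simpa [compReal] using hpq⟩
  have hqW : q.eval₂ C W ≠ 0 := fun h => hq0 ((transcendental_iff.mp hW) _ h)
  rw [eq_div_iff hqW] at hpq
  obtain ⟨p₁, p₂, hp⟩ := exists_real_imaginary_parts p
  obtain ⟨q₁, q₂, hq⟩ := exists_real_imaginary_parts q
  simp only [hp, hq, Polynomial.eval₂_add, Polynomial.eval₂_mul, Polynomial.eval₂_C,
    Polynomial.eval₂_map] at hpq
  -- The real and imaginary parts of β q(W) - p(W) vanish separately; whichever of q₁, q₂ is nonzero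
  -- yields a real fraction.
  obtain ⟨h₁, h₂⟩ := ConjAlong.eq_zero_of_add_I_mul hl
    ((hβ.mul hl (hWl.eval₂_ofReal hl q₁)).sub hl (hWl.eval₂_ofReal hl p₁))
    ((hβ.mul hl (hWl.eval₂_ofReal hl q₂)).sub hl (hWl.eval₂_ofReal hl p₂))
    (by linear_combination hpq)
  by_cases hq₁ : q₁ = 0
  · have hq₂ : q₂ ≠ 0 := by
      rintro rfl
      exact hq0 (by simp [hq, hq₁])
    exact ⟨_, ((compReal_div hW p₂ hq₂).trans
      ((eq_div_iff (eval₂_real_ne_zero hW hq₂)).mpr (sub_eq_zero.mp h₂)).symm).symm⟩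
  · exact ⟨_, ((compReal_div hW p₁ hq₁).trans
      ((eq_div_iff (eval₂_real_ne_zero hW hq₁)).mpr (sub_eq_zero.mp h₁)).symm).symm⟩

/-! ### Lines, circles and their parametrization -/

theorem C_mem_adjoin {k : Type*} [Field k] (W : RatFunc k) (c : k) : C c ∈ k⟮W⟯ :=
  k⟮W⟯.algebraMap_mem c

/-- A pair of functions with real values along `l` that lies on a real line or circle has a
rational parametrization by a function with real values along `l`. -/
theorem exists_real_parameter {l : Filter ℂ} [l.NeBot] (hl : l ≤ cofinite) {a b : RatFunc ℂ}
    (ha : ConjAlong l a a) (hb : ConjAlong l b b) (hab : ∀ c, a + C Complex.I * b ≠ C c)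
    {A B D E : ℝ} (hne : ¬(A = 0 ∧ B = 0 ∧ D = 0 ∧ E = 0))
    (h : C (A : ℂ) * (a * a + b * b) + C (B : ℂ) * a + C (D : ℂ) * b + C (E : ℂ) = 0) :
    ∃ W, ConjAlong l W W ∧ a ∈ ℂ⟮W⟯ ∧ b ∈ ℂ⟮W⟯ := by
  have hC : ∀ {r : ℝ}, r ≠ 0 → C (r : ℂ) ≠ 0 := fun hr =>
    (_root_.map_ne_zero _).mpr (Complex.ofReal_ne_zero.mpr hr)
  by_cases hA : A = 0
  · subst hA
    simp only [Complex.ofReal_zero, map_zero, zero_mul, zero_add] at h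
    by_cases hB : B = 0
    · subst hB
      simp only [Complex.ofReal_zero, map_zero, zero_mul, zero_add] at h
      have hD : D ≠ 0 := by
        rintro rfl
        simp only [Complex.ofReal_zero, map_zero, zero_mul, zero_add, map_eq_zero,
          Complex.ofReal_eq_zero] at h
        exact hne ⟨rfl, rfl, rfl, h⟩
      refine ⟨a, ha, mem_adjoin_simple_self _ _, ?_⟩
      have : b = -C (E : ℂ) / C (D : ℂ) := by
        rw [eq_div_iff (hC hD)]; linear_combination h
      rw [this]
      exact div_mem (neg_mem (C_mem_adjoin _ _)) (C_mem_adjoin _ _)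
    · refine ⟨b, hb, ?_, mem_adjoin_simple_self _ _⟩
      have : a = -(C (D : ℂ) * b + C (E : ℂ)) / C (B : ℂ) := by
        rw [eq_div_iff (hC hB)]; linear_combination h
      rw [this]
      exact div_mem (neg_mem (add_mem (mul_mem (C_mem_adjoin _ _) (mem_adjoin_simple_self _ _))
        (C_mem_adjoin _ _))) (C_mem_adjoin _ _)
  · set x := a + C ((B / (2 * A) : ℝ) : ℂ) with hx
    set y := b + C ((D / (2 * A) : ℝ) : ℂ) with hy
    have hxl : ConjAlong l x x := ha.add hl (ConjAlong.C_ofReal _)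
    have hyl : ConjAlong l y y := hb.add hl (ConjAlong.C_ofReal _)
    have hxy : ∀ c, x + C Complex.I * y ≠ C c := by
      intro c hc
      refine hab (c - (B / (2 * A) : ℝ) - Complex.I * (D / (2 * A) : ℝ)) ?_
      rw [map_sub, map_sub, map_mul]
      linear_combination hc
    have hcirc : x * x + y * y = C (((B ^ 2 + D ^ 2) / (4 * A ^ 2) - E / A : ℝ) : ℂ) := by
      have hA' := hC hA
      simp only [hx, hy, Complex.ofReal_div, Complex.ofReal_mul, Complex.ofReal_sub,
        Complex.ofReal_add, Complex.ofReal_pow, map_div₀, map_mul, map_sub, map_add, map_pow,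
        Complex.ofReal_ofNat, map_ofNat]
      field_simp
      linear_combination 16 * C (A : ℂ) * h
    have hρ := hxl.nonneg_of_sq_add_sq hl hyl hcirc
    obtain ⟨r, hr⟩ : ∃ r : ℝ, (B ^ 2 + D ^ 2) / (4 * A ^ 2) - E / A = r * r :=
      ⟨_, (Real.mul_self_sqrt hρ).symm⟩
    rw [hr, Complex.ofReal_mul, map_mul] at hcirc
    have hI : C Complex.I * C Complex.I = -1 := by
      rw [← map_mul, Complex.I_mul_I, map_neg, map_one]
    -- Radius zero would give (x + iy)(x - iy) = 0, making a + ib constant.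
    have hr0 : r ≠ 0 := by
      rintro rfl
      have h0 : (x + C Complex.I * y) * (x + C Complex.I * (-y)) = 0 := by
        simp only [Complex.ofReal_zero, map_zero, mul_zero] at hcirc
        linear_combination hcirc - y * y * hI
      rcases mul_eq_zero.mp h0 with h0 | h0
      · exact hxy 0 (by simpa using h0)
      · obtain ⟨h₁, h₂⟩ := ConjAlong.eq_zero_of_add_I_mul hl hxl (hyl.neg hl) h0
        exact hxy 0 (by simp [h₁, neg_eq_zero.mp h₂])
    have hxr : x + C (r : ℂ) ≠ 0 := by
      intro h0
      have hx0 : x = -C (r : ℂ) := eq_neg_of_add_eq_zero_left h0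
      have hy0 : y = 0 := by
        rw [hx0] at hcirc
        exact mul_self_eq_zero.mp (by linear_combination hcirc)
      exact hxy (-r) (by rw [hx0, hy0, mul_zero, add_zero, map_neg])
    -- Stereographic projection from (-r, 0), with inverse x + r = 2r / (1 + W²), y = W(x + r).
    set W := y / (x + C (r : ℂ)) with hW
    have hyW : y = W * (x + C (r : ℂ)) := (div_mul_cancel₀ _ hxr).symm
    have hWmem := mem_adjoin_simple_self ℂ W
    have hrel : (1 + W * W) * (x + C (r : ℂ)) = 2 * C (r : ℂ) := by
      apply mul_right_cancel₀ hxr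
      linear_combination hcirc - (y + W * (x + C (r : ℂ))) * hyW
    have hW1 : 1 + W * W ≠ 0 := by
      intro h0
      rw [h0, zero_mul] at hrel
      exact mul_ne_zero two_ne_zero (hC hr0) hrel.symm
    have hxrW : x + C (r : ℂ) ∈ ℂ⟮W⟯ := by
      rw [(eq_div_iff hW1).mpr ((mul_comm _ _).trans hrel)]
      exact div_mem (mul_mem (ofNat_mem _ 2) (C_mem_adjoin _ _))
        (add_mem (one_mem _) (mul_mem hWmem hWmem))
    refine ⟨W, hyl.div hl (hxl.add hl (ConjAlong.C_ofReal _)), ?_, ?_⟩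
    · rw [show a = x + C (r : ℂ) - C (r : ℂ) - C ((B / (2 * A) : ℝ) : ℂ) by rw [hx]; ring]
      exact sub_mem (sub_mem hxrW (C_mem_adjoin _ _)) (C_mem_adjoin _ _)
    · rw [show b = y - C ((D / (2 * A) : ℝ) : ℂ) by rw [hy]; ring, hyW]
      exact sub_mem (mul_mem hWmem hxrW) (C_mem_adjoin _ _)

/-- A bilinear relation between conjugate functions `a + I b` and `a - I b` gives the equation
of a real line or circle. -/
theorem exists_circle_relation {l : Filter ℂ} [l.NeBot] (hl : l ≤ cofinite) {a b : RatFunc ℂ}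
    (ha : ConjAlong l a a) (hb : ConjAlong l b b) {p q r s : ℂ}
    (hne : ¬(p = 0 ∧ q = 0 ∧ r = 0 ∧ s = 0))
    (h : (a - C Complex.I * b) * (C r * (a + C Complex.I * b) + C s)
      = C p * (a + C Complex.I * b) + C q) :
    ∃ A B D E : ℝ, ¬(A = 0 ∧ B = 0 ∧ D = 0 ∧ E = 0) ∧
      C (A : ℂ) * (a * a + b * b) + C (B : ℂ) * a + C (D : ℂ) * b + C (E : ℂ) = 0 := by
  have hI : C Complex.I * C Complex.I = -1 := by
    rw [← map_mul, Complex.I_mul_I, map_neg, map_one]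
  have hsplit : ∀ z : ℂ, C z = C (z.re : ℂ) + C Complex.I * C (z.im : ℂ) := fun z => by
    rw [← map_mul, ← map_add, mul_comm, Complex.re_add_im]
  have hreal : ∀ A B D E : ℝ, ConjAlong l
      (C (A : ℂ) * (a * a + b * b) + C (B : ℂ) * a + C (D : ℂ) * b + C (E : ℂ))
      (C (A : ℂ) * (a * a + b * b) + C (B : ℂ) * a + C (D : ℂ) * b + C (E : ℂ)) :=
    fun A B D E => ((((ConjAlong.C_ofReal A).mul hl ((ha.mul hl ha).add hl (hb.mul hl hb))).add hl
      ((ConjAlong.C_ofReal B).mul hl ha)).add hl ((ConjAlong.C_ofReal D).mul hl hb)).add hl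
        (ConjAlong.C_ofReal E)
  -- Expanded, the relation is r(a² + b²) + (s - p)a - i(s + p)b - q = 0. Its real and imaginary
  -- parts are two real equations, not both trivial.
  obtain ⟨h₁, h₂⟩ := ConjAlong.eq_zero_of_add_I_mul hl
    (hreal r.re (s.re - p.re) (s.im + p.im) (-q.re))
    (hreal r.im (s.im - p.im) (-(s.re + p.re)) (-q.im)) (by
      rw [hsplit p, hsplit q, hsplit r, hsplit s] at h
      simp only [Complex.ofReal_sub, Complex.ofReal_add, Complex.ofReal_neg, map_sub, map_add,
        map_neg]
      linear_combination h + (b * b * (C (r.re : ℂ) + C Complex.I * C (r.im : ℂ))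
        + b * (C (s.im : ℂ) + C (p.im : ℂ))) * hI)
  by_cases h0 : r.re = 0 ∧ s.re - p.re = 0 ∧ s.im + p.im = 0 ∧ -q.re = 0
  · refine ⟨_, _, _, _, fun h0' => hne ?_, h₂⟩
    obtain ⟨e₁, e₂, e₃, e₄⟩ := h0
    obtain ⟨f₁, f₂, f₃, f₄⟩ := h0'
    refine ⟨?_, ?_, ?_, ?_⟩ <;> apply Complex.ext <;> simp only [Complex.zero_re, Complex.zero_im]
      <;> linarith
  · exact ⟨_, _, _, _, h0, h₁⟩

/-! ### Assembly -/

/-- Two rational functions with real values along `l`, the first of which is not constant, are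
real functions of a common rational function. -/
theorem exists_common_compReal {l : Filter ℂ} [l.NeBot] (hl : l ≤ cofinite)
    {β₁ β₂ : RatFunc ℂ} (hβ₁ : ∀ c, β₁ ≠ C c) (h₁ : ConjAlong l β₁ β₁)
    (h₂ : ConjAlong l β₂ β₂) :
    ∃ (W : RatFunc ℂ) (P₁ P₂ : RatFunc ℝ), β₁ = P₁.compReal W ∧ β₂ = P₂.compReal W := by
  have hbot : conjugableField l hl ≠ ⊥ := by
    intro h
    have : β₁ ∈ conjugableField l hl := ⟨_, h₁⟩
    rw [h, IntermediateField.mem_bot] at this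
    obtain ⟨c, hc⟩ := this
    exact hβ₁ c hc.symm
  set w := Luroth.generator (conjugableField l hl) with hw
  have hgen : conjugableField l hl = ℂ⟮w⟯ := Luroth.eq_adjoin_generator
  obtain ⟨w', hw'⟩ : w ∈ conjugableField l hl := Luroth.generator_mem
  have hgen' : ℂ⟮w⟯ = ℂ⟮w'⟯ := by
    refine le_antisymm (hgen ▸ hw'.conjugableField_le_adjoin hl hgen.le) ?_
    rw [adjoin_simple_le_iff, ← hgen]
    exact ⟨w, hw'.symm⟩
  obtain ⟨p, q, r, s, hne, hrel⟩ :=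
    exists_bilinear_relation (Luroth.transcendental_generator hbot) hgen'
  have hI : C Complex.I * C Complex.I = -1 := by
    rw [← map_mul, Complex.I_mul_I, map_neg, map_one]
  set a := C ((1 / 2 : ℝ) : ℂ) * (w + w') with ha
  set b := C ((1 / 2 : ℝ) : ℂ) * (C Complex.I * w' - C Complex.I * w) with hb
  have hhalf : C ((1 / 2 : ℝ) : ℂ) = 1 / 2 := by
    rw [Complex.ofReal_div, map_div₀]; simp only [Complex.ofReal_one, Complex.ofReal_ofNat, map_one, map_ofNat]
  have hwab : w = a + C Complex.I * b := by
    rw [ha, hb, hhalf]; linear_combination (w - w') / 2 * hI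
  have hwab' : w' = a - C Complex.I * b := by
    rw [ha, hb, hhalf]; linear_combination (w' - w) / 2 * hI
  have hal : ConjAlong l a a := by
    have := (ConjAlong.C_ofReal (1 / 2)).mul hl (hw'.add hl hw'.symm)
    rwa [add_comm w' w] at this
  have hbl : ConjAlong l b b := by
    have := (ConjAlong.C_ofReal (1 / 2)).mul hl
      (((ConjAlong.C Complex.I).mul hl hw'.symm).sub hl ((ConjAlong.C Complex.I).mul hl hw'))
    rw [Complex.conj_I, map_neg, neg_mul, neg_mul, neg_sub_neg] at this
    exact this
  rw [← hw, hwab', hwab] at hrel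
  obtain ⟨A, B, D, E, hne', hcirc⟩ := exists_circle_relation hl hal hbl hne hrel
  obtain ⟨W, hWl, haW, hbW⟩ := exists_real_parameter hl hal hbl
    (fun c hc => Luroth.generator_ne_C hbot ⟨c, hwab.trans hc⟩) hne' hcirc
  have hle : conjugableField l hl ≤ ℂ⟮W⟯ := by
    rw [hgen, adjoin_simple_le_iff, hwab]
    exact add_mem haW (mul_mem (C_mem_adjoin _ _) hbW)
  -- A constant W would collapse L to ℂ, but β₁ lies in L.
  have hWtr : Transcendental ℂ W := by
    refine transcendental_of_ne_C _ fun ⟨c, hc⟩ => hbot (le_bot_iff.mp (hle.trans ?_))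
    rw [hc, adjoin_simple_le_iff]
    exact IntermediateField.algebraMap_mem _ c
  obtain ⟨P₁, hP₁⟩ := exists_eq_compReal hl hWtr hWl h₁ (hle ⟨_, h₁⟩)
  obtain ⟨P₂, hP₂⟩ := exists_eq_compReal hl hWtr hWl h₂ (hle ⟨_, h₂⟩)
  exact ⟨W, P₁, P₂, hP₁, hP₂⟩

/-- A real value is finite, so z is not a pole and `sphereMap` agrees with `eval` there. -/
theorem conj_eval_of_sphereMap_mem {β : RatFunc ℂ} {K : Set ℝ} {z : ℂ}
    (h : β.sphereMap (OnePoint.some z) ∈ realSetInSphere K) :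
    β.eval (RingHom.id ℂ) z = conj (β.eval (RingHom.id ℂ) z) := by
  obtain ⟨x, -, hx⟩ := h
  simp only [sphereMap] at hx
  split_ifs at hx
  · exact absurd hx (OnePoint.coe_ne_infty _)
  · have : (x : ℂ) = β.num.eval z / β.denom.eval z := OnePoint.coe_injective hx
    simp only [eval, Polynomial.eval₂_id]
    rw [← this, Complex.conj_ofReal]

end RatFunc

theorem theorem2 (β₁ β₂ : RatFunc ℂ)
    (hβ₁ : ∀ c : ℂ, β₁ ≠ RatFunc.C c) (hβ₂ : ∀ c : ℂ, β₂ ≠ RatFunc.C c)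
    (K₁ K₂ : Set ℝ)
    (hinf : (β₁.sphereMap ⁻¹' realSetInSphere K₁ ∩
      β₂.sphereMap ⁻¹' realSetInSphere K₂).Infinite) :
    ∃ (W : RatFunc ℂ) (P₁ P₂ : RatFunc ℝ),
      β₁ = P₁.compReal W ∧ β₂ = P₂.compReal W := by
  set T := β₁.sphereMap ⁻¹' realSetInSphere K₁ ∩ β₂.sphereMap ⁻¹' realSetInSphere K₂
  set S : Set ℂ := (OnePoint.some : ℂ → OnePoint ℂ) ⁻¹' T with hS
  have hSinf : S.Infinite := by
    intro hfin
    refine hinf (((hfin.image OnePoint.some).insert OnePoint.infty).subset fun t ht => ?_)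
    induction t using OnePoint.rec with
    | infty => exact Set.mem_insert _ _
    | coe z => exact Set.mem_insert_of_mem _ ⟨z, ht, rfl⟩
  have : (cofinite ⊓ 𝓟 S).NeBot := cofinite_inf_principal_neBot_iff.mpr hSinf
  refine RatFunc.exists_common_compReal (l := cofinite ⊓ 𝓟 S) inf_le_left hβ₁ ?_ ?_
  · filter_upwards [mem_inf_of_right (mem_principal_self S)] with z hz
    exact RatFunc.conj_eval_of_sphereMap_mem hz.1
  · filter_upwards [mem_inf_of_right (mem_principal_self S)] with z hz
    exact RatFunc.conj_eval_of_sphereMap_mem hz.2
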